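/- Let $n\ge 2$, let $\mathfrak t^*=(\mathbb R^n)^*$ with its standard basis $x_1,\dots,x_n$, and let $\mathbb S(\mathfrak t^*)=\mathbb R[x_1,\dots,x_n]$. Let $W=W(D_n)$ be the Weyl group of type $D_n$ (for $n=2$, $D_2=A_1\times A_1$), that is, the group of signed permutations $(u,\epsilon)$, $u\in S_n$, $\epsilon\in\{\pm1\}^n$, with $\epsilon_1\cdots\epsilon_n=1$, acting on $\mathbb S(\mathfrak t^*)$ by algebra automorphisms with $(u,\epsilon)\cdot x_k=\epsilon_k x_{u(k)}$. The positive roots are $\Delta^+=\{x_i\pm x_j : 1\le i<j\le n\}$, and $s_\beta\in W$ is the reflection in $\beta$. Let $H_\alpha(W(D_n))$ be the $\mathbb S(\mathfrak t^*)$-algebra, under pointwise operations, of all maps $f\colon W\to\mathbb S(\mathfrak t^*)$ such that $$f(ws_\beta)-f(w)\in (w\beta)\,\mathbb S(\mathfrak t^*)\qquad\text{for all } w\in W,\ \beta\in\Delta^+ .$$ A map $f$ is called $W$-invariant if $w^{-1}\cdot f(wv)=f(v)$ for all $v,w\in W$. For $I=[i_1,\dots,i_n]\in\mathbb Z_{\ge0}^n$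 put $\mathbf x^I=x_1^{i_1}\cdots x_n^{i_n}$ and define $c_I\colon W\to \mathbb S(\mathfrak t^*)$ by $$c_I(v)=v\cdot\mathbf x^I,\qquad\text{i.e.}\qquad c_I((u,\epsilon))=(\epsilon_1x_{u(1)})^{i_1}\cdots(\epsilon_nx_{u(n)})^{i_n}.$$ Define sets of multi-indices $\mathcal D_n\subset\mathbb Z_{\ge0}^n$ for $n\geq 2$ inductively: $\mathcal D_2=\{[0,0],[1,0],[2,0],[0,1]\}$, and for $n\ge3$, $[i_1,\dots,i_n]\in\mathcal D_n$ if and only if either $0\le i_1\le 2n-2$ and $[i_2,\dots,i_n]\in\mathcal D_{n-1}$, or $i_1=0$ and $[i_2-1,\dots,i_n-1]\in\mathcal D_{n-1}$. Theorem. For every $I\in\mathcal D_n$ the map $c_I$ is a $W$-invariant element of $H_\alpha(W(D_n))$, and the family $(c_I)_{I\in\mathcal D_n}$ is a basis of the $\mathbb S(\mathfrak t^*)$-module $H_\alpha(W(D_n))$. Consequently, the monomials $\mathbf x^I$, $I\in\mathcal D_n$, form a basis of $\mathbb S(\mathfrak t^*)$ as a module over the ring of invariants $\mathbb S(\mathfrak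 t^*)^W$. -/

import Mathlib

noncomputable section

namespace TypeD

open MvPolynomial

/-- `S(𝔱*) = ℝ[x₁, …, xₙ]`, where `x₁, …, xₙ` is the standard basis of `𝔱* = (ℝⁿ)*`
(indexed here by `Fin n`). -/
abbrev S (n : ℕ) : Type := MvPolynomial (Fin n) ℝ

/-- A signed permutation `(u, ε)` of `n` letters. -/
@[ext]
structure SignedPerm (n : ℕ) where
  /-- the underlying permutation `u` -/
  perm : Equiv.Perm (Fin n)
  /-- the signs `ε` -/
  sign : Fin n → ℤˣ

namespace SignedPerm

variable {n : ℕ}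

instance : Mul (SignedPerm n) := ⟨fun w v => ⟨w.perm * v.perm, fun k => v.sign k * w.sign (v.perm k)⟩⟩
instance : One (SignedPerm n) := ⟨⟨1, fun _ => 1⟩⟩
instance : Inv (SignedPerm n) := ⟨fun w => ⟨w.perm⁻¹, fun k => w.sign (w.perm⁻¹ k)⟩⟩

@[simp] theorem mul_perm (w v : SignedPerm n) : (w * v).perm = w.perm * v.perm := rfl
@[simp] theorem mul_sign (w v : SignedPerm n) (k : Fin n) :
    (w * v).sign k = v.sign k * w.sign (v.perm k) := rfl
@[simp] theorem one_perm : (1 : SignedPerm n).perm = 1 := rfl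
@[simp] theorem one_sign (k : Fin n) : (1 : SignedPerm n).sign k = 1 := rfl
@[simp] theorem inv_perm (w : SignedPerm n) : (w⁻¹).perm = w.perm⁻¹ := rfl
@[simp] theorem inv_sign (w : SignedPerm n) (k : Fin n) :
    (w⁻¹).sign k = w.sign (w.perm⁻¹ k) := rfl

/-- The group of signed permutations: the product is composition of the actions
`(u, ε) · x_k = ε_k x_{u(k)}`. -/
instance : Group (SignedPerm n) :=
  Group.ofLeftAxioms
    (by
      intro a b c
      ext k
      · rfl
      · simp [mul_assoc])
    (by
      intro a
      ext k
      · rfl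
      · simp)
    (by
      intro a
      ext k
      · simp
      · simp)

/-- The algebra endomorphism of `S(𝔱*)` extending `x_k ↦ ε_k x_{u(k)}`. -/
def toAlgHom (w : SignedPerm n) : S n →ₐ[ℝ] S n :=
  aeval fun k => ((w.sign k : ℤ) : S n) * X (w.perm k)

/-- The action of signed permutations on `S(𝔱*)` by algebra automorphisms,
`(u, ε) · x_k = ε_k x_{u(k)}`. -/
instance : MulSemiringAction (SignedPerm n) (S n) where
  smul w f := w.toAlgHom f
  one_smul f := by
    have h : toAlgHom (1 : SignedPerm n) = AlgHom.id ℝ (S n) := by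
      ext k
      simp [toAlgHom]
    exact DFunLike.congr_fun h f
  mul_smul w v f := by
    have h : toAlgHom (w * v) = (toAlgHom w).comp (toAlgHom v) := by
      ext1 k
      simp [toAlgHom, mul_assoc]
    exact DFunLike.congr_fun h f
  smul_zero w := map_zero w.toAlgHom
  smul_add w := map_add w.toAlgHom
  smul_one w := map_one w.toAlgHom
  smul_mul w := map_mul w.toAlgHom

theorem smul_def (w : SignedPerm n) (f : S n) : w • f = w.toAlgHom f := rfl

@[simp] theorem smul_X (w : SignedPerm n) (k : Fin n) :
    w • (X k : S n) = ((w.sign k : ℤ) : S n) * X (w.perm k) := by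
  simp [smul_def, toAlgHom]

instance : SMulCommClass (SignedPerm n) ℝ (S n) := ⟨fun w r f => map_smul w.toAlgHom r f⟩

end SignedPerm

/-- The Weyl group `W = W(D_n)`: signed permutations with an even number of sign changes. -/
def W (n : ℕ) : Subgroup (SignedPerm n) where
  carrier := {w | ∏ k, w.sign k = 1}
  one_mem' := by simp
  mul_mem' := by
    intro a b ha hb
    change ∏ k, a.sign k = 1 at ha
    change ∏ k, b.sign k = 1 at hb
    change ∏ k, (a * b).sign k = 1
    simp only [SignedPerm.mul_sign, Finset.prod_mul_distrib]
    rw [hb, Equiv.prod_comp b.perm a.sign, ha, one_mul]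
  inv_mem' := by
    intro a ha
    change ∏ k, a.sign k = 1 at ha
    change ∏ k, (a⁻¹).sign k = 1
    simp only [SignedPerm.inv_sign]
    rw [Equiv.prod_comp a.perm⁻¹ a.sign, ha]

theorem mem_W {n : ℕ} {w : SignedPerm n} : w ∈ W n ↔ ∏ k, w.sign k = 1 := Iff.rfl

/-- The positive roots of `D_n` are `x_i - σ x_j` for `i < j` and `σ = ± 1`. -/
def root {n : ℕ} (i j : Fin n) (σ : ℤˣ) : S n := X i - ((σ : ℤ) : S n) * X j

/-- The reflection `s_β` in the root `β = x_i - σ x_j` with `i ≠ j`: the transposition `(i, j)`,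
with both signs changed if `σ = -1`. -/
def refl {n : ℕ} (i j : Fin n) (hij : i ≠ j) (σ : ℤˣ) : W n :=
  ⟨⟨Equiv.swap i j, fun k => if k = i ∨ k = j then σ else 1⟩, by
    rw [mem_W, Finset.prod_ite]
    have h : (Finset.univ.filter fun k : Fin n => k = i ∨ k = j) = {i, j} := by
      ext k
      simp
    simp [h, Finset.card_pair hij]⟩

/-- `refl` is the orthogonal reflection: `s_β x_k = x_k - (2⟨x_k, β⟩ / ⟨β, β⟩) β`, where
`⟨β, β⟩ = 2` and `⟨x_k, β⟩` is the coefficient of `x_k` in `β`. -/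
theorem refl_smul_X {n : ℕ} (i j : Fin n) (hij : i ≠ j) (σ : ℤˣ) (k : Fin n) :
    refl i j hij σ • (X k : S n) =
      X k - C (coeff (Finsupp.single k 1) (root i j σ)) * root i j σ := by
  have hc : ∀ l : Fin n, coeff (Finsupp.single k 1) (X l : S n) = if l = k then 1 else 0 := by
    intro l
    rw [coeff_X]
    simp [Finsupp.single_left_inj]
  have h1 : refl i j hij σ • (X k : S n) =
      (((if k = i ∨ k = j then σ else 1 : ℤˣ) : ℤ) : S n) * X (Equiv.swap i j k) :=
    SignedPerm.smul_X _ _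
  have hC : ((σ : ℤ) : S n) = C ((σ : ℤ) : ℝ) := by simp
  have hσ : ((σ : ℤ) : S n) * ((σ : ℤ) : S n) = 1 := by
    rcases Int.units_eq_one_or σ with h | h <;> simp [h]
  have h2 : coeff (Finsupp.single k 1) (root i j σ) =
      (if i = k then 1 else 0) - ((σ : ℤ) : ℝ) * (if j = k then 1 else 0) := by
    rw [root, hC, coeff_sub, coeff_C_mul, hc, hc]
  rw [h1, h2, root]
  rcases eq_or_ne k i with rfl | hki
  · simp [hij.symm]
  · rcases eq_or_ne k j with rfl | hkj
    · simp only [or_true, if_true, hki.symm, if_false, mul_one, zero_sub, Equiv.swap_apply_right,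
        map_neg, ← hC]
      linear_combination (X k : S n) * hσ
    · simp [hki, hkj, hki.symm, hkj.symm, Equiv.swap_apply_of_ne_of_ne]

/-- `W` is the group generated by the reflections in the roots. -/
theorem closure_refl (n : ℕ) :
    Subgroup.closure {s : W n | ∃ (i j : Fin n) (hij : i < j) (σ : ℤˣ), s = refl i j hij.ne σ} =
      ⊤ := by
  set K := Subgroup.closure
    {s : W n | ∃ (i j : Fin n) (hij : i < j) (σ : ℤˣ), s = refl i j hij.ne σ} with hK
  have hrefl : ∀ (i j : Fin n) (hij : i ≠ j) (σ : ℤˣ), refl i j hij σ ∈ K := by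
    intro i j hij σ
    rcases lt_or_gt_of_ne hij with h | h
    · exact Subgroup.subset_closure ⟨i, j, h, σ, rfl⟩
    · refine Subgroup.subset_closure ⟨j, i, h, σ, ?_⟩
      apply Subtype.ext
      ext k
      · simp [refl, Equiv.swap_comm]
      · simp [refl, or_comm]
  have hperm : ∀ u : Equiv.Perm (Fin n),
      (⟨⟨u, fun _ => 1⟩, by simp [mem_W]⟩ : W n) ∈ K := by
    intro u
    induction u using Equiv.Perm.swap_induction_on with
    | one => exact K.one_mem
    | swap_mul f x y hxy ih =>
      convert K.mul_mem (hrefl x y hxy 1) ih using 1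
      apply Subtype.ext
      ext k
      · simp [refl]
      · simp [refl]
  have hsign : ∀ (m : ℕ) (ε : Fin n → ℤˣ) (hε : ∏ k, ε k = 1),
      (Finset.univ.filter fun k => ε k ≠ 1).card ≤ m →
        (⟨⟨1, ε⟩, hε⟩ : W n) ∈ K := by
    intro m
    induction m with
    | zero =>
      intro ε hε h
      have h0 : ε = fun _ => 1 := by
        funext k
        by_contra hk
        have : k ∈ Finset.univ.filter fun k => ε k ≠ 1 := by simp [hk]
        rw [Finset.card_eq_zero.mp (Nat.le_zero.mp h)] at this
        simp at this
      subst h0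
      exact K.one_mem
    | succ m ih =>
      intro ε hε h
      by_cases h0 : ∃ i, ε i ≠ 1
      · obtain ⟨i, hi⟩ := h0
        have h1 : ∃ j, j ≠ i ∧ ε j ≠ 1 := by
          by_contra! hne
          rw [Finset.prod_eq_single i (fun j _ hj => hne j hj) (by simp)] at hε
          exact hi hε
        obtain ⟨j, hji, hj⟩ := h1
        have hi' : ε i = -1 := (Int.units_eq_one_or _).resolve_left hi
        have hj' : ε j = -1 := (Int.units_eq_one_or _).resolve_left hj
        have hmem := K.mul_mem (hrefl i j hji.symm 1) (hrefl i j hji.symm (-1))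
        set t : W n := refl i j hji.symm 1 * refl i j hji.symm (-1) with ht
        have htp : t.1.perm = 1 := by simp [ht, refl]
        have hts : ∀ k, t.1.sign k = if k = i ∨ k = j then -1 else 1 := by
          intro k
          simp [ht, refl]
        let v : W n := ⟨⟨1, ε⟩, hε⟩
        have hprod : (t * v).1 = ⟨1, fun k => ε k * t.1.sign k⟩ := by
          ext k
          · simp [v, htp]
          · simp [v]
        have hprod' : ∏ k, ε k * t.1.sign k = 1 := by
          have := (t * v).2
          rw [hprod] at this
          exact this
        have hlt := ih (fun k => ε k * t.1.sign k) hprod' (by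
          refine Nat.le_of_lt_succ (lt_of_lt_of_le (Finset.card_lt_card ?_) h)
          rw [Finset.ssubset_iff_of_subset]
          · exact ⟨i, by simp [hi], by simp [hts, hi']⟩
          · intro k
            simp only [Finset.mem_filter, Finset.mem_univ, true_and, hts]
            by_cases hk : k = i ∨ k = j
            · rcases hk with rfl | rfl <;> simp [hi', hj']
            · simp [hk])
        have htv : t * v ∈ K := by
          convert hlt using 1
          exact Subtype.ext hprod
        exact (K.mul_mem_cancel_left hmem).mp htv
      · push Not at h0
        have h0' : ε = fun _ => 1 := funext h0
        subst h0'
        exact K.one_mem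
  rw [eq_top_iff]
  intro w _
  convert K.mul_mem (hperm w.1.perm) (hsign _ w.1.sign w.2 le_rfl) using 1
  apply Subtype.ext
  ext k
  · simp
  · simp

/-- The cohomology ring `H_α(W)` of the GKM graph of `W = W(D_n)`, an algebra over `S(𝔱*)`: the
maps `f : W → S(𝔱*)` with `f(w s_β) - f(w) ∈ (w β) S(𝔱*)` for all `w ∈ W` and all positive
roots `β`. -/
def H (n : ℕ) : Subalgebra (S n) (W n → S n) where
  carrier := {f | ∀ (w : W n) (i j : Fin n) (hij : i < j) (σ : ℤˣ),
    w • root i j σ ∣ f (w * refl i j hij.ne σ) - f w}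
  mul_mem' := by
    intro f g hf hg w i j hij σ
    have h : (f * g) (w * refl i j hij.ne σ) - (f * g) w =
        (f (w * refl i j hij.ne σ) - f w) * g (w * refl i j hij.ne σ) +
          f w * (g (w * refl i j hij.ne σ) - g w) := by
      simp only [Pi.mul_apply]
      ring
    rw [h]
    exact dvd_add ((hf w i j hij σ).mul_right _) ((hg w i j hij σ).mul_left _)
  add_mem' := by
    intro f g hf hg w i j hij σ
    have h : (f + g) (w * refl i j hij.ne σ) - (f + g) w =
        (f (w * refl i j hij.ne σ) - f w) + (g (w * refl i j hij.ne σ) - g w) := by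
      simp only [Pi.add_apply]
      ring
    rw [h]
    exact dvd_add (hf w i j hij σ) (hg w i j hij σ)
  algebraMap_mem' := by
    intro r w i j hij σ
    simp [Pi.algebraMap_apply]

/-- The action of `W` on maps `f : W → S(𝔱*)`: `(w · f)(v) = w⁻¹ f(w v)`. -/
def act {n : ℕ} (w : W n) (f : W n → S n) : W n → S n := fun v => w⁻¹ • f (w * v)

/-- The map `c_T(f)(v) = v · f`. -/
def cT {n : ℕ} (f : S n) : W n → S n := fun v => v • f

/-- The monomial `x^I`. -/
def mono {n : ℕ} (I : Fin n → ℕ) : S n := ∏ k, X k ^ I k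

/-- The class `c_I = c_T(x^I)`. -/
def c {n : ℕ} (I : Fin n → ℕ) : W n → S n := cT (mono I)

/-- `c_I(u, ε) = (ε₁ x_{u(1)})^{i₁} ⋯ (εₙ x_{u(n)})^{iₙ}`. -/
theorem c_apply {n : ℕ} (I : Fin n → ℕ) (w : W n) :
    c I w = ∏ k, (((w.1.sign k : ℤ) : S n) * X (w.1.perm k)) ^ I k := by
  have h : c I w = w.1.toAlgHom (mono I) := rfl
  rw [h]
  simp [mono, SignedPerm.toAlgHom]

/-- The index set `𝒟_n`, defined inductively for `n ≥ 2` (the values at `0` and `1` are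
placeholders). In the second case the multi-index `[i₂ - 1, …, iₙ - 1]` is `J`. -/
def 𝒟 : (n : ℕ) → Set (Fin n → ℕ)
  | 0 => ∅
  | 1 => ∅
  | 2 => {![0, 0], ![1, 0], ![2, 0], ![0, 1]}
  | m + 3 => {I | (I 0 ≤ 2 * (m + 3) - 2 ∧ Fin.tail I ∈ 𝒟 (m + 2)) ∨
      (I 0 = 0 ∧ ∃ J ∈ 𝒟 (m + 2), ∀ k, Fin.tail I k = J k + 1)}

/-- The subring of invariants `S(𝔱*)^W`. -/
abbrev invariants (n : ℕ) : Subring (S n) := FixedPoints.subring (S n) (W n)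

end TypeD

end

/-! The proof is a determinant computation. Form the `|W| × |W|` matrix `classMatrix` with columns
`c_I`; this is possible because there are exactly `|W|` exponents (`card_exps`, `card_W`).

Its determinant is nonzero. The monomials `x^I` span `S` over the invariants (`mem_span_mono`), so a
row vector `a` killing all columns satisfies `∑ a_w (w • s) = 0` for every `s`, and Dedekind's
independence of characters gives `a = 0`.

Its determinant is also divisible by the product of all `β ^ (|W|/2)`, `β` a positive root. Rows `w`
and `s_β w` are congruent modulo `β` for columns in `H`, and distinct positive roots are coprime
(`rootProd_dvd_det`). The degrees of the `x^I` add up to the degree of this product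
(`two_mul_sum_exps`), so the determinant is a nonzero constant times it.

By Cramer's rule every `f ∈ H` is then an `S`-combination of the `c_I`: the numerators are
determinants with columns in `H`, hence divisible by the denominator. Independence of the `c_I`,
combined with the spanning result, also gives the basis over the invariants. -/

noncomputable section

namespace TypeD

/-! ### Spanning by monomials over a subring. -/

section Spanning

variable {R : Type*} [CommRing R]

-- At a root `a` of `P`, the value of `(P - P(0))/X` is formally `-P(0)/a`; for `P = (X - a)Q` this
-- is `Q(0)`, with no division by `a` needed.
open Polynomial in
theorem eval_divX_X_sub_C_mul (a : R) (Q : R[X]) :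
    (divX ((X - C a) * Q)).eval a = Q.coeff 0 := by
  have h : divX ((X - C a) * Q) = Q - C a * divX Q := by
    ext k
    simp [sub_mul, coeff_divX]
  have h2 := congrArg (eval a) (divX_mul_X_add Q)
  simp only [eval_add, eval_mul, eval_X, eval_C] at h2
  rw [h]
  simp only [eval_sub, eval_mul, eval_C]
  linear_combination -h2

-- The coefficients of the quotient by a monic linear factor are found recursively from the top
-- degree down.
open Polynomial in
theorem coeff_mem_of_X_sub_C_mul (B : Subring R) {a : R} (ha : a ∈ B) (Q : R[X])
    (h : ∀ k, ((X - C a) * Q).coeff k ∈ B) (k : ℕ) : Q.coeff k ∈ B := by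
  have key : ∀ d k : ℕ, Q.natDegree < k + d → Q.coeff k ∈ B := by
    intro d
    induction d with
    | zero =>
      intro k hk
      rw [coeff_eq_zero_of_natDegree_lt (by simpa using hk)]
      exact B.zero_mem
    | succ d ih =>
      intro k hk
      have h1 := h (k + 1)
      have h2 := ih (k + 1) (by omega)
      have h3 : Q.coeff k = ((X - C a) * Q).coeff (k + 1) + a * Q.coeff (k + 1) := by
        simp [sub_mul]
      rw [h3]
      exact B.add_mem h1 (B.mul_mem ha h2)
  exact key (Q.natDegree + 1) k (by omega)

open Polynomial in
/-- If `a e ∈ A` and `± e²` is a monic polynomial of degree `m` in `a²` with coefficients in `A`,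
then `A[a, e]` is spanned over `A` by `e` and the powers `aⁱ` with `i ≤ 2 m`. -/
theorem adjoin_pair_le_span (A : Subring R) (a e : R) (m : ℕ) (Q : R[X])
    (hQ : ∀ k, Q.coeff k ∈ A) (hmonic : Q.Monic) (hdeg : Q.natDegree = m) (hae : a * e ∈ A)
    (u : ℤˣ) (hev : Q.eval (a ^ 2) = ((u : ℤ) : R) * e ^ 2) (y : R)
    (hy : y ∈ Algebra.adjoin A {a, e}) :
    y ∈ Submodule.span A (insert e ((fun i => a ^ i) '' Set.Iic (2 * m))) := by
  set V := Submodule.span A (insert e ((fun i => a ^ i) '' Set.Iic (2 * m))) with hV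
  have hsm : ∀ r ∈ A, ∀ v ∈ V, r * v ∈ V := fun r hr v hv => V.smul_mem ⟨r, hr⟩ hv
  have he : e ∈ V := Submodule.subset_span (Set.mem_insert _ _)
  have hpow : ∀ i ≤ 2 * m, a ^ i ∈ V := fun i hi =>
    Submodule.subset_span (Set.mem_insert_of_mem _ ⟨i, hi, rfl⟩)
  have hA : ∀ r ∈ A, r ∈ V := fun r hr => by
    simpa using hsm r hr _ (hpow 0 (Nat.zero_le _))
  have hu : ((u : ℤ) : R) * ((u : ℤ) : R) = 1 := by
    rcases Int.units_eq_one_or u with h | h <;> simp [h]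
  have hsum : Q.eval (a ^ 2) = ∑ k ∈ Finset.range m, Q.coeff k * a ^ (2 * k) + a ^ (2 * m) := by
    rw [eval_eq_sum_range, hdeg, Finset.sum_range_succ, ← hdeg, hmonic.coeff_natDegree, hdeg]
    simp [pow_mul]
  have hee : e * e ∈ V := by
    have h1 : e * e = ((u : ℤ) : R) * Q.eval (a ^ 2) := by
      rw [hev]; linear_combination (-e ^ 2) * hu
    rw [h1, hsum]
    refine hsm _ (intCast_mem A _) _ (V.add_mem (V.sum_mem fun k hk => ?_) (hpow _ le_rfl))
    have := Finset.mem_range.mp hk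
    exact hsm _ (hQ k) _ (hpow _ (by omega))
  -- Multiply the relation by `a`: `a Q(a²) = ±(a e) e` lies in `A e`, so the first power outside
  -- the list reduces to lower ones.
  have htop : a ^ (2 * m + 1) ∈ V := by
    have h1 : a ^ (2 * m + 1) = (((u : ℤ) : R) * (a * e)) * e -
        ∑ k ∈ Finset.range m, Q.coeff k * a ^ (2 * k + 1) := by
      have h2 : ∑ k ∈ Finset.range m, Q.coeff k * a ^ (2 * k + 1) =
          a * ∑ k ∈ Finset.range m, Q.coeff k * a ^ (2 * k) := by
        rw [Finset.mul_sum]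
        exact Finset.sum_congr rfl fun k _ => by ring
      rw [h2]
      linear_combination a * hev - a * hsum
    rw [h1]
    refine V.sub_mem (hsm _ (A.mul_mem (intCast_mem A _) hae) _ he) (V.sum_mem fun k hk => ?_)
    have := Finset.mem_range.mp hk
    exact hsm _ (hQ k) _ (hpow _ (by omega))
  have hgen : ∀ g : R, (g * e ∈ V) → (∀ i ≤ 2 * m, g * a ^ i ∈ V) → ∀ v ∈ V, g * v ∈ V := by
    intro g h1 h2 v hv
    refine Submodule.span_induction ?_ ?_ ?_ ?_ hv
    · rintro _ (rfl | ⟨i, hi, rfl⟩)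
      · exact h1
      · exact h2 i hi
    · simp
    · intro x y _ _ hx hy
      rw [mul_add]
      exact V.add_mem hx hy
    · intro r x _ hx
      rw [mul_smul_comm]
      exact V.smul_mem r hx
  have ha_mul : ∀ v ∈ V, a * v ∈ V := by
    refine hgen a (hA _ hae) fun i hi => ?_
    rw [← pow_succ']
    rcases hi.lt_or_eq with h | h
    · exact hpow _ h
    · rw [h]; exact htop
  -- Since `e a^(i+1) = (a e) a^i` with `a e ∈ A`, no mixed products are needed as generators.
  have he_mul : ∀ v ∈ V, e * v ∈ V := by
    refine hgen e hee fun i hi => ?_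
    cases i with
    | zero => simpa using he
    | succ i =>
      have : e * a ^ (i + 1) = (a * e) * a ^ i := by ring
      rw [this]
      exact hsm _ hae _ (hpow _ (by omega))
  have hmul : ∀ v ∈ V, y * v ∈ V := by
    refine Algebra.adjoin_induction (p := fun y _ => ∀ v ∈ V, y * v ∈ V) ?_ ?_ ?_ ?_ hy
    · rintro _ (rfl | rfl)
      · exact ha_mul
      · exact he_mul
    · intro r v hv
      exact hsm _ r.2 v hv
    · intro x y _ _ hx hy v hv
      rw [add_mul]
      exact V.add_mem (hx v hv) (hy v hv)
    · intro x y _ _ hx hy v hv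
      rw [mul_assoc]
      exact hx _ (hy v hv)
  simpa using hmul 1 (hA 1 A.one_mem)

/-- The exponents of the monomial basis in `n + 1` variables. -/
def exps : (n : ℕ) → Finset (Fin (n + 1) → ℕ)
  | 0 => {0}
  | n + 1 => (Finset.range (2 * n + 3) ×ˢ exps n).image (fun p => Fin.cons p.1 p.2) ∪
      (exps n).image (fun J => Fin.cons 0 fun k => J k + 1)

theorem cons_mem_exps {n i : ℕ} {J : Fin (n + 1) → ℕ} (hi : i ≤ 2 * n + 2) (hJ : J ∈ exps n) :
    (Fin.cons i J : Fin (n + 2) → ℕ) ∈ exps (n + 1) := by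
  rw [exps, Finset.mem_union, Finset.mem_image]
  exact Or.inl ⟨(i, J), by simp [hJ]; omega, rfl⟩

theorem cons_zero_mem_exps {n : ℕ} {J : Fin (n + 1) → ℕ} (hJ : J ∈ exps n) :
    (Fin.cons 0 fun k => J k + 1 : Fin (n + 2) → ℕ) ∈ exps (n + 1) := by
  rw [exps, Finset.mem_union, Finset.mem_image, Finset.mem_image]
  exact Or.inr ⟨J, hJ, rfl⟩

-- The subring is arbitrary so that the induction can enlarge it. With `a = x 0` and `e` the product
-- of the other variables, `B = A[a, e]` satisfies the same hypotheses for those variables.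
-- Multiplying the spanning set `e, a^i` of `B` over `A` by the tail monomials gives the two
-- families in `exps`.
open Polynomial in
theorem mem_span_monomials (n : ℕ) (A : Subring R) (x : Fin (n + 1) → R) (he : ∏ k, x k ∈ A)
    (hP : ∀ d, (∏ k, (X - C (x k ^ 2))).coeff d ∈ A) (s : R)
    (hs : s ∈ Subring.closure ((A : Set R) ∪ Set.range x)) :
    s ∈ Submodule.span A ((fun I : Fin (n + 1) → ℕ => ∏ k, x k ^ I k) '' (exps n : Set _)) := by
  induction n generalizing A with
  | zero =>
    have hx : (A : Set R) ∪ Set.range x ⊆ A := by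
      refine Set.union_subset subset_rfl ?_
      rintro _ ⟨k, rfl⟩
      obtain rfl : k = 0 := Fin.ext (by omega)
      simpa using he
    have hsA : s ∈ A := Subring.closure_le.mpr hx hs
    have h1 : (1 : R) ∈ Submodule.span A
        ((fun I : Fin (0 + 1) → ℕ => ∏ k, x k ^ I k) '' (exps 0 : Set _)) :=
      Submodule.subset_span ⟨0, by simp [exps], by simp⟩
    simpa [Subring.smul_def] using Submodule.smul_mem _ (⟨s, hsA⟩ : A) h1
  | succ n ih =>
    set a := x 0 with ha
    set e := ∏ k : Fin (n + 1), x k.succ with he'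
    set P' : R[X] := ∏ k : Fin (n + 1), (X - C (x k.succ ^ 2)) with hP'
    have hae : a * e ∈ A := by rwa [Fin.prod_univ_succ] at he
    simp only [Fin.prod_univ_succ (fun k => X - C (x k ^ 2))] at hP
    rw [← ha, ← hP'] at hP
    have hmon' : P'.Monic := monic_prod_of_monic _ _ fun k _ => monic_X_sub_C _
    nontriviality R
    have hdeg' : P'.natDegree = n + 1 := by
      rw [hP', natDegree_prod_of_monic _ _ fun k _ => monic_X_sub_C _]
      simp only [natDegree_X_sub_C, Finset.sum_const, Finset.card_univ, Fintype.card_fin,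
        smul_eq_mul, mul_one]
    have hmon : ((X - C (a ^ 2)) * P').Monic := (monic_X_sub_C _).mul hmon'
    have hdeg : ((X - C (a ^ 2)) * P').natDegree = n + 2 := by
      rw [(monic_X_sub_C _).natDegree_mul hmon', hdeg', natDegree_X_sub_C]
      ring
    have hP0 : P'.coeff 0 = (((-1 : ℤˣ) ^ (n + 1) : ℤˣ) : ℤ) * e ^ 2 := by
      rw [coeff_zero_eq_eval_zero, hP', eval_prod, he', ← Finset.prod_pow]
      simp [Finset.prod_neg]
    -- `divX` only shifts coefficients, so they stay in `A`; its value at `a²` is `P'(0) = ±e²`.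
    have hspan := adjoin_pair_le_span A a e (n + 1) (divX ((X - C (a ^ 2)) * P'))
      (fun k => by rw [coeff_divX]; exact hP _)
      (by
        rw [Monic, leadingCoeff, natDegree_divX_eq_natDegree_tsub_one, coeff_divX, hdeg]
        have := hmon.coeff_natDegree
        rwa [hdeg] at this)
      (by rw [natDegree_divX_eq_natDegree_tsub_one, hdeg]; rfl) hae ((-1) ^ (n + 1))
      (by rw [eval_divX_X_sub_C_mul, hP0])
    set B := Algebra.adjoin A ({a, e} : Set R) with hB
    have haB : a ∈ B := Algebra.subset_adjoin (by simp)
    have heB : e ∈ B := Algebra.subset_adjoin (by simp)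
    have hAB : ∀ r ∈ A, r ∈ B := fun r hr => B.algebraMap_mem ⟨r, hr⟩
    have hs' : s ∈ Subring.closure ((B.toSubring : Set R) ∪ Set.range fun k => x (Fin.succ k)) := by
      refine Subring.closure_le.mpr ?_ hs
      rintro y (hy | ⟨k, rfl⟩)
      · exact Subring.subset_closure (Or.inl (hAB y hy))
      · refine Fin.cases ?_ (fun k => ?_) k
        · exact Subring.subset_closure (Or.inl haB)
        · exact Subring.subset_closure (Or.inr ⟨k, rfl⟩)
    have hmem := ih B.toSubring (fun k => x k.succ) heB
      (coeff_mem_of_X_sub_C_mul B.toSubring (pow_mem haB 2) P' fun k => hAB _ (hP k)) hs'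
    set V := Submodule.span A
      ((fun I : Fin (n + 1 + 1) → ℕ => ∏ k, x k ^ I k) '' (exps (n + 1) : Set _)) with hV
    have hJ : ∀ J ∈ exps n, ∀ b ∈ B, b * ∏ k : Fin (n + 1), x k.succ ^ J k ∈ V := by
      intro J hJ b hb
      refine Submodule.span_induction
        (p := fun b _ => b * ∏ k : Fin (n + 1), x k.succ ^ J k ∈ V) ?_ ?_ ?_ ?_ (hspan b hb)
      · rintro _ (rfl | ⟨i, hi, rfl⟩)
        · refine Submodule.subset_span ⟨_, cons_zero_mem_exps hJ, ?_⟩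
          simp [Fin.prod_univ_succ, pow_succ, Finset.prod_mul_distrib, he', mul_comm]
        · refine Submodule.subset_span ⟨_, cons_mem_exps hi hJ, ?_⟩
          simp [Fin.prod_univ_succ, ha]
      · simp
      · intro y z _ _ hy hz
        rw [add_mul]
        exact V.add_mem hy hz
      · intro r y _ hy
        rw [smul_mul_assoc]
        exact V.smul_mem r hy
    have hBV : ∀ b ∈ B, ∀ v ∈ Submodule.span B.toSubring
        ((fun I : Fin (n + 1) → ℕ => ∏ k, x (Fin.succ k) ^ I k) '' (exps n : Set _)), b * v ∈ V := by
      intro b hb v hv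
      induction hv using Submodule.span_induction generalizing b with
      | mem y hy =>
        obtain ⟨J, hJm, rfl⟩ := hy
        exact hJ J hJm b hb
      | zero => simp
      | add y z _ _ hy hz =>
        rw [mul_add]
        exact V.add_mem (hy b hb) (hz b hb)
      | smul r y _ hy =>
        rw [Subring.smul_def, smul_eq_mul, ← mul_assoc]
        exact hy _ (B.mul_mem hb r.2)
    simpa using hBV 1 B.one_mem s hmem

end Spanning

end TypeD
end
noncomputable section

namespace TypeD

/-! ### Number and total degree of the exponents. -/

section Counting

/-- This makes the two families in `exps` disjoint: tails in the second have only positive entries.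
-/
theorem exists_eq_zero_of_mem_exps {n : ℕ} {I : Fin (n + 1) → ℕ} (hI : I ∈ exps n) :
    ∃ k, I k = 0 := by
  induction n with
  | zero => exact ⟨0, by simp [exps] at hI; simp [hI]⟩
  | succ n ih =>
    rw [exps, Finset.mem_union, Finset.mem_image, Finset.mem_image] at hI
    rcases hI with ⟨⟨i, J⟩, h, rfl⟩ | ⟨J, _, rfl⟩
    · obtain ⟨k, hk⟩ := ih (Finset.mem_product.mp h).2
      exact ⟨k.succ, by simpa using hk⟩
    · exact ⟨0, rfl⟩

theorem sum_exps_succ {M : Type*} [AddCommMonoid M] (n : ℕ) (g : (Fin (n + 2) → ℕ) → M) :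
    ∑ I ∈ exps (n + 1), g I =
      ∑ i ∈ Finset.range (2 * n + 3), ∑ J ∈ exps n, g (Fin.cons i J) +
        ∑ J ∈ exps n, g (Fin.cons 0 fun k => J k + 1) := by
  rw [exps, Finset.sum_union, Finset.sum_image, Finset.sum_image, Finset.sum_product]
  · intro J _ J' _ h
    have h2 := (Fin.cons_injective2 h).2
    funext k
    simpa using congrFun h2 k
  · rintro ⟨i, J⟩ _ ⟨i', J'⟩ _ h
    obtain ⟨h1, h2⟩ := Fin.cons_injective2 h
    exact Prod.ext h1 h2
  · rw [Finset.disjoint_left]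
    intro I h1 h2
    obtain ⟨⟨i, J⟩, h, rfl⟩ := Finset.mem_image.mp h1
    obtain ⟨J', _, h'⟩ := Finset.mem_image.mp h2
    obtain ⟨k, hk⟩ := exists_eq_zero_of_mem_exps (Finset.mem_product.mp h).2
    have h3 := congrFun (Fin.cons_injective2 h').2 k
    simp only at h3
    have hk' : J k = 0 := hk
    omega

theorem card_exps (n : ℕ) : (exps n).card = (n + 1).factorial * 2 ^ n := by
  induction n with
  | zero => simp [exps]
  | succ n ih =>
    rw [Finset.card_eq_sum_ones, sum_exps_succ]
    simp only [Finset.sum_const, Finset.card_range, smul_eq_mul, mul_one, ih]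
    rw [Nat.factorial_succ (n + 1)]
    ring

/-- The average degree is half the number `(n + 1) n` of positive roots, which is what the degree
comparison for the determinant requires. -/
theorem two_mul_sum_exps (n : ℕ) :
    2 * ∑ I ∈ exps n, ∑ k, I k = (n + 1) * n * (exps n).card := by
  induction n with
  | zero => simp [exps]
  | succ n ih =>
    have h1 : (exps (n + 1)).card = (2 * n + 4) * (exps n).card := by
      rw [card_exps, card_exps, Nat.factorial_succ (n + 1)]
      ring
    have h2 := Finset.sum_range_id_mul_two (2 * n + 3)
    have h3 : 2 * n + 3 - 1 = 2 * n + 2 := by omega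
    rw [h3] at h2
    rw [sum_exps_succ, h1]
    simp only [Fin.sum_univ_succ (n := n + 1), Fin.cons_zero, Fin.cons_succ, zero_add,
      Finset.sum_add_distrib, Finset.sum_const, Finset.card_range, Finset.card_univ,
      Fintype.card_fin, smul_eq_mul, mul_one]
    set s := ∑ J ∈ exps n, ∑ k, J k with hs
    set t := ∑ i ∈ Finset.range (2 * n + 3), i with ht
    have h4 : ∑ i ∈ Finset.range (2 * n + 3), (exps n).card * i = (exps n).card * t := by
      rw [ht, Finset.mul_sum]
    rw [h4]
    linear_combination (2 * n + 4) * ih + (exps n).card * h2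

/-- The recursion may start from the single exponent `0` in one variable; `𝒟 2` is then its first
step. -/
theorem 𝒟_eq_exps (n : ℕ) : 𝒟 (n + 2) = (exps (n + 1) : Set (Fin (n + 2) → ℕ)) := by
  have hrec : ∀ (m : ℕ) (I : Fin (m + 2) → ℕ), I ∈ exps (m + 1) ↔
      (I 0 ≤ 2 * m + 2 ∧ Fin.tail I ∈ exps m) ∨
        (I 0 = 0 ∧ ∃ J ∈ exps m, ∀ k, Fin.tail I k = J k + 1) := by
    intro m I
    constructor
    · intro h
      rw [exps, Finset.mem_union, Finset.mem_image, Finset.mem_image] at h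
      rcases h with ⟨⟨i, J⟩, h, rfl⟩ | ⟨J, h, rfl⟩
      · obtain ⟨h1, h2⟩ := Finset.mem_product.mp h
        have := Finset.mem_range.mp h1
        exact Or.inl ⟨by simp only [Fin.cons_zero]; omega, by simpa using h2⟩
      · exact Or.inr ⟨rfl, J, h, fun k => by simp⟩
    · rintro (⟨h1, h2⟩ | ⟨h1, J, hJ, h2⟩)
      · rw [← Fin.cons_self_tail I]
        exact cons_mem_exps h1 h2
      · rw [← Fin.cons_self_tail I, h1, funext h2]
        exact cons_zero_mem_exps hJ
  induction n with
  | zero =>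
    ext I
    rw [Finset.mem_coe, hrec]
    obtain ⟨a, b, rfl⟩ : ∃ a b, I = ![a, b] := ⟨I 0, I 1, by ext k; fin_cases k <;> rfl⟩
    simp only [𝒟, exps, Set.mem_insert_iff, Set.mem_singleton_iff, Finset.mem_singleton,
      funext_iff, Fin.forall_fin_succ, Fin.tail]
    simp only [Matrix.cons_val_zero, Matrix.cons_val_succ, Fin.succ_zero_eq_one, Pi.zero_apply]
    have h : (∃ J : Fin (0 + 1) → ℕ, J 0 = 0 ∧ b = J 0 + 1) ↔ b = 1 :=
      ⟨by rintro ⟨J, h1, h2⟩; omega, fun h => ⟨0, rfl, h⟩⟩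
    simp
    rw [h]
    omega
  | succ n ih =>
    ext I
    rw [Finset.mem_coe, hrec, 𝒟, ih]
    rfl

end Counting

/-! ### The order of `W`. -/

section Group

/-- An element of `W(D_{n+1})` is determined by its permutation and all signs but the first. -/
def equivPermSigns (n : ℕ) : W (n + 1) ≃ Equiv.Perm (Fin (n + 1)) × (Fin n → ℤˣ) where
  toFun w := (w.1.perm, Fin.tail w.1.sign)
  invFun p := ⟨⟨p.1, Fin.cons (∏ k, p.2 k) p.2⟩, by
    simp [mem_W, Fin.prod_univ_succ, Int.units_mul_self]⟩
  left_inv w := by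
    have h := mem_W.mp w.2
    rw [Fin.prod_univ_succ] at h
    apply Subtype.ext
    ext k : 2
    · rfl
    · refine Fin.cases ?_ (fun k => ?_) k
      · simp only [Fin.cons_zero]
        exact (eq_inv_of_mul_eq_one_left h).trans (Int.units_inv_eq_self _) |>.symm
      · rfl
  right_inv p := by simp

instance (n : ℕ) : Finite (W n) := by
  cases n with
  | zero =>
    have : Subsingleton (W 0) := ⟨fun a b => by
      apply Subtype.ext
      ext k
      · exact k.elim0
      · exact k.elim0⟩
    infer_instance
  | succ n => exact Finite.of_equiv _ (equivPermSigns n).symm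

instance (n : ℕ) : Fintype (W n) := Fintype.ofFinite _

instance (n : ℕ) : DecidableEq (W n) := Classical.decEq _

theorem card_W (n : ℕ) : Fintype.card (W (n + 1)) = (n + 1).factorial * 2 ^ n := by
  rw [Fintype.card_congr (equivPermSigns n)]
  simp [Fintype.card_perm]

end Group

end TypeD
end
noncomputable section

namespace TypeD

open MvPolynomial

/-! ### Positive roots as pairwise coprime irreducible polynomials. -/

section Roots

variable {n : ℕ}

theorem coeff_root {i j : Fin n} (hij : i ≠ j) (σ : ℤˣ) :
    coeff (Finsupp.single i 1) (root i j σ : S n) = 1 := by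
  have hC : ((σ : ℤ) : S n) = C ((σ : ℤ) : ℝ) := by simp
  rw [root, hC, coeff_sub, coeff_C_mul, coeff_X, coeff_X]
  simp [Finsupp.single_left_inj, hij.symm]

theorem root_ne_zero {i j : Fin n} (hij : i ≠ j) (σ : ℤˣ) : (root i j σ : S n) ≠ 0 := by
  intro h
  simpa [h] using coeff_root hij σ

theorem totalDegree_root {i j : Fin n} (hij : i ≠ j) (σ : ℤˣ) :
    (root i j σ : S n).totalDegree = 1 := by
  have hC : ((σ : ℤ) : S n) = C ((σ : ℤ) : ℝ) := by simp
  refine IsHomogeneous.totalDegree ?_ (root_ne_zero hij σ)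
  rw [root, hC]
  exact (isHomogeneous_X _ _).sub ((isHomogeneous_X _ _).C_mul _)

theorem irreducible_root {i j : Fin n} (hij : i ≠ j) (σ : ℤˣ) :
    Irreducible (root i j σ : S n) :=
  irreducible_of_totalDegree_eq_one (totalDegree_root hij σ) fun _ hx =>
    isUnit_of_dvd_one (coeff_root hij σ ▸ hx (Finsupp.single i 1))

theorem isRelPrime_root {i j i' j' : Fin n} (hij : i < j) (hij' : i' < j') {σ σ' : ℤˣ}
    (h : (i, j, σ) ≠ (i', j', σ')) : IsRelPrime (root i j σ : S n) (root i' j' σ') := by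
  refine (irreducible_root hij.ne σ).dvd_or_isRelPrime.resolve_left fun hdvd => ?_
  -- This point lies on the hyperplane of `x_i - σ x_j` and of no other positive root: the remaining
  -- coordinates are distinct and at least `2`.
  let pt : Fin n → ℤ := fun k => if k = i then σ else if k = j then 1 else (k : ℤ) + 2
  have hev : ∀ (a b : Fin n) (τ : ℤˣ),
      aeval (fun k => (pt k : ℝ)) (root a b τ : S n) = ((pt a - τ * pt b : ℤ) : ℝ) := by
    intro a b τ
    simp [root]
  have h1 := map_dvd (aeval fun k => (pt k : ℝ)) hdvd
  rw [hev, hev] at h1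
  have h2 : pt i - σ * pt j = 0 := by simp [pt, hij.ne']
  rw [h2, Int.cast_zero, zero_dvd_iff, Int.cast_eq_zero] at h1
  simp only [pt] at h1
  rw [Fin.lt_def] at hij hij'
  simp only [ne_eq, Prod.mk.injEq, not_and, Fin.ext_iff] at h
  simp only [Fin.ext_iff] at h1
  rcases Int.units_eq_one_or σ with rfl | rfl <;> rcases Int.units_eq_one_or σ' with rfl | rfl <;>
    simp only [Units.val_one, Units.val_neg] at h1 <;> simp at h <;> split_ifs at h1 <;> omega

/-- The positive roots `x_i - σ x_j`, `i < j`. -/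
def posRoots (n : ℕ) : Finset (Fin n × Fin n × ℤˣ) := Finset.univ.filter fun p => p.1 < p.2.1

theorem card_posRoots (n : ℕ) : (posRoots (n + 1)).card = (n + 1) * n := by
  have h1 : posRoots (n + 1) = Finset.univ.biUnion fun i : Fin (n + 1) =>
      (Finset.Ioi i ×ˢ (Finset.univ : Finset ℤˣ)).map ⟨fun p => (i, p), Prod.mk_right_injective i⟩ := by
    ext ⟨i, j, σ⟩
    simpa [posRoots] using fun _ => Int.units_eq_one_or σ
  rw [h1, Finset.card_biUnion]
  · simp only [Finset.card_map, Finset.card_product, Fin.card_Ioi, Finset.card_univ,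
      Fintype.card_units_int]
    rw [← Finset.sum_mul, Fin.sum_univ_eq_sum_range (fun i => n + 1 - 1 - i) (n + 1),
      Finset.sum_range_reflect (fun i => i) (n + 1), Finset.sum_range_id_mul_two]
    rfl
  · intro i _ i' _ hii
    rw [Function.onFun, Finset.disjoint_left]
    rintro ⟨a, p⟩ h h'
    simp only [Finset.mem_map, Function.Embedding.coeFn_mk, Prod.mk.injEq] at h h'
    obtain ⟨_, _, rfl, _⟩ := h
    obtain ⟨_, _, rfl, _⟩ := h'
    exact hii rfl

end Roots

/-! ### Divisibility of determinants with congruent rows. -/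

section Determinant

/-- If the rows of a matrix indexed by `w` and `τ w` are congruent modulo `γ`, for a map `τ`
sending the complement of `T` into `T`, then `γ ^ |Tᶜ|` divides the determinant. -/
theorem pow_dvd_det {R m : Type*} [CommRing R] [Fintype m] [DecidableEq m] (N : Matrix m m R)
    (γ : R) (τ : m → m) (T : m → Prop) [DecidablePred T] (hT : ∀ w, ¬ T w → T (τ w))
    (hN : ∀ w k, γ ∣ N (τ w) k - N w k) :
    γ ^ (Finset.univ.filter fun w => ¬ T w).card ∣ N.det := by
  choose q hq using hN
  -- Row operations subtracting row `τ w` from row `w` for `w` outside `T`; as `τ w ∈ T`, `E` is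
  -- block triangular with identity blocks.
  let E : Matrix m m R := fun w v => if w = v then 1 else if ¬ T w ∧ v = τ w then -1 else 0
  have hE : E.det = 1 := by
    rw [Matrix.twoBlockTriangular_det' E T]
    · have h1 : Matrix.toSquareBlockProp E T = 1 := by
        ext ⟨a, ha⟩ ⟨b, hb⟩
        change E a b = _
        simp [E, Matrix.one_apply, ha]
      have h2 : Matrix.toSquareBlockProp E (fun i => ¬ T i) = 1 := by
        ext ⟨a, ha⟩ ⟨b, hb⟩
        have : b ≠ τ a := fun h => hb (h ▸ hT a ha)
        change E a b = _
        simp [E, Matrix.one_apply, this]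
      rw [h1, h2, Matrix.det_one, Matrix.det_one, one_mul]
    · intro a ha b hb
      have : a ≠ b := fun h => hb (h ▸ ha)
      simp [E, ha, this]
  let D : m → R := fun w => if T w then 1 else γ
  let N' : Matrix m m R := fun w k => if T w then N w k else -q w k
  have hEN : E * N = Matrix.diagonal D * N' := by
    ext w k
    rw [Matrix.diagonal_mul, Matrix.mul_apply]
    by_cases hw : T w
    · simp [E, D, N', hw]
    · have hne : w ≠ τ w := fun h => hw (h ▸ hT w hw)
      have h1 : ∀ v, E w v * N v k =
          (if w = v then N v k else 0) + (if v = τ w then -N v k else 0) := by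
        intro v
        by_cases h : w = v
        · subst h
          simp [E, hne]
        · by_cases h' : v = τ w
          · subst h'
            simp [E, hne, hw]
          · simp [E, h, h']
      simp only [h1, Finset.sum_add_distrib, Finset.sum_ite_eq, Finset.sum_ite_eq',
        Finset.mem_univ, if_true]
      simp only [D, N', hw, if_false]
      linear_combination -hq w k
  have h3 := congrArg Matrix.det hEN
  rw [Matrix.det_mul, Matrix.det_mul, hE, one_mul, Matrix.det_diagonal] at h3
  rw [h3]
  refine Dvd.dvd.mul_right (dvd_of_eq ?_) _
  simp only [D]
  rw [Finset.prod_ite]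
  simp

end Determinant

/-! ### Reflections, congruences and the classes `c_I`. -/

section Congruence

variable {n : ℕ}

theorem smul_root (w : W n) (a b : Fin n) (τ : ℤˣ) :
    w • (root a b τ : S n) = ((w.1.sign a : ℤ) : S n) *
      root (w.1.perm a) (w.1.perm b) (τ * w.1.sign a * w.1.sign b) := by
  have h : w • (root a b τ : S n) = w.1.toAlgHom (root a b τ) := rfl
  rw [h]
  rcases Int.units_eq_one_or (w.1.sign a) with h1 | h1
  · simp [root, SignedPerm.toAlgHom, h1, mul_assoc]
  · simp [root, SignedPerm.toAlgHom, h1]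
    ring

/-- This is the conjugation rule `w s_β w⁻¹ = s_{wβ}`. -/
theorem mul_refl (w : W n) (a b : Fin n) (hab : a ≠ b) (τ : ℤˣ) :
    w * refl a b hab τ = refl (w.1.perm a) (w.1.perm b) (w.1.perm.injective.ne hab)
      (τ * w.1.sign a * w.1.sign b) * w := by
  apply Subtype.ext
  ext k : 2
  · simp only [refl, Subgroup.coe_mul, SignedPerm.mul_perm]
    rw [Equiv.mul_swap_eq_swap_mul]
  · simp only [refl, Subgroup.coe_mul, SignedPerm.mul_sign, EmbeddingLike.apply_eq_iff_eq]
    by_cases ha : k = a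
    · subst ha
      simp only [true_or, if_true, Equiv.swap_apply_left]
      rcases Int.units_eq_one_or (w.1.sign k) with h1 | h1 <;> simp [h1]
    · by_cases hb : k = b
      · subst hb
        simp only [or_true, if_true, Equiv.swap_apply_right]
        rcases Int.units_eq_one_or (w.1.sign k) with h1 | h1 <;> simp [h1, mul_comm]
      · simp [ha, hb, Equiv.swap_apply_of_ne_of_ne]

theorem root_swap (i j : Fin n) (σ : ℤˣ) :
    (root j i σ : S n) = -((σ : ℤ) : S n) * root i j σ := by
  rcases Int.units_eq_one_or σ with h | h <;> simp [root, h, add_comm]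

theorem refl_swap (i j : Fin n) (hij : i ≠ j) (σ : ℤˣ) : refl j i hij.symm σ = refl i j hij σ := by
  apply Subtype.ext
  ext k : 2
  · simp [refl, Equiv.swap_comm]
  · simp [refl, or_comm]

/-- Passing from right to left multiplication by reflections makes the modulus independent of `w`,
as the row operations require. -/
theorem root_dvd_of_mem_H {f : W n → S n} (hf : f ∈ H n) (i j : Fin n) (hij : i ≠ j) (σ : ℤˣ)
    (w : W n) : root i j σ ∣ f (refl i j hij σ * w) - f w := by
  have hmul : ∀ (p q : S n) (ε : ℤˣ), ((ε : ℤ) : S n) * p ∣ q → p ∣ q := fun p q ε h =>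
    (Dvd.intro_left _ rfl).trans h
  set a := w.1.perm⁻¹ i with ha
  set b := w.1.perm⁻¹ j with hb
  have hai : w.1.perm a = i := by simp [ha]
  have hbj : w.1.perm b = j := by simp [hb]
  have hab : a ≠ b := fun h => hij (by rw [← hai, ← hbj, h])
  set τ := σ * w.1.sign a * w.1.sign b with hτ
  have hστ : τ * w.1.sign a * w.1.sign b = σ := by
    rcases Int.units_eq_one_or (w.1.sign a) with h1 | h1 <;>
    rcases Int.units_eq_one_or (w.1.sign b) with h2 | h2 <;> simp [hτ, h1, h2]
  have h1 : w * refl a b hab τ = refl i j hij σ * w := by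
    rw [mul_refl]
    simp only [hai, hbj, hστ]
  have h2 : w • (root a b τ : S n) = ((w.1.sign a : ℤ) : S n) * root i j σ := by
    rw [smul_root, hai, hbj, hστ]
  rw [← h1]
  refine hmul _ _ (w.1.sign a) ?_
  rw [← h2]
  -- The inverse permutation may reverse the order of the indices; the root then changes only by a
  -- sign.
  rcases lt_or_gt_of_ne hab with h | h
  · exact hf w a b h τ
  · have h3 := hf w b a h τ
    rw [refl_swap a b hab, root_swap a b] at h3
    exact (dvd_mul_of_dvd_right dvd_rfl _ |>.trans (dvd_of_eq (smul_mul' w _ _).symm)).trans h3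

/-- A reflection is trivial modulo its root on constants and variables, and `p ↦ s p - p` obeys a
twisted Leibniz rule. -/
theorem root_dvd_refl_smul_sub (i j : Fin n) (hij : i ≠ j) (σ : ℤˣ) (p : S n) :
    root i j σ ∣ refl i j hij σ • p - p := by
  induction p using MvPolynomial.induction_on with
  | C r =>
    have h : refl i j hij σ • (C r : S n) = C r := (refl i j hij σ).1.toAlgHom.commutes r
    rw [h, sub_self]
    exact dvd_zero _
  | add p q hp hq =>
    rw [smul_add, add_sub_add_comm]
    exact dvd_add hp hq
  | mul_X p k hp =>
    have h : refl i j hij σ • (p * X k) - p * X k =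
        (refl i j hij σ • p - p) * (refl i j hij σ • X k) +
          p * (refl i j hij σ • X k - X k) := by
      rw [smul_mul']
      ring
    rw [h]
    refine dvd_add (hp.mul_right _) (Dvd.dvd.mul_left ?_ _)
    rw [refl_smul_X]
    exact ⟨-C (coeff (Finsupp.single k 1) (root i j σ)), by ring⟩

theorem c_mem_H (I : Fin n → ℕ) : c I ∈ H n := by
  intro w i j hij σ
  obtain ⟨q, hq⟩ := root_dvd_refl_smul_sub i j hij.ne σ (mono I)
  refine ⟨w • q, ?_⟩
  rw [← smul_mul', ← hq, smul_sub, smul_smul]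
  rfl

theorem act_c (I : Fin n → ℕ) (w : W n) : act w (c I) = c I := by
  funext v
  change w⁻¹ • ((w * v) • mono I) = v • mono I
  rw [smul_smul, inv_mul_cancel_left]

end Congruence

/-! ### The product of root powers dividing the determinant. -/

section Product

variable {n : ℕ}

/-- The product of all positive roots, each to the power `|W| / 2`. -/
def rootProd (n : ℕ) : S n :=
  ∏ p ∈ posRoots n, root p.1 p.2.1 p.2.2 ^ (Fintype.card (W n) / 2)

/-- Left multiplication by a reflection in `x_i ± x_j` exchanges this set with its complement, so
one choice of half of `W` serves both signs. -/
theorem card_filter_not_lt (i j : Fin n) (hij : i ≠ j) :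
    (Finset.univ.filter fun w : W n => ¬ w.1.perm⁻¹ i < w.1.perm⁻¹ j).card =
      Fintype.card (W n) / 2 := by
  have hinv : ∀ w : W n, (refl i j hij 1 * w).1.perm⁻¹ i = w.1.perm⁻¹ j ∧
      (refl i j hij 1 * w).1.perm⁻¹ j = w.1.perm⁻¹ i := by
    intro w
    simp [refl]
  have h1 : (Finset.univ.filter fun w : W n => w.1.perm⁻¹ i < w.1.perm⁻¹ j).card =
      (Finset.univ.filter fun w : W n => ¬ w.1.perm⁻¹ i < w.1.perm⁻¹ j).card := by
    refine Finset.card_equiv (Equiv.mulLeft (refl i j hij 1)) fun w => ?_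
    have hne : w.1.perm⁻¹ i ≠ w.1.perm⁻¹ j := fun h => hij ((w.1.perm⁻¹).injective h)
    simp only [Finset.mem_filter, Finset.mem_univ, true_and, Equiv.coe_mulLeft, (hinv w).1,
      (hinv w).2, not_lt]
    exact ⟨le_of_lt, fun h => lt_of_le_of_ne h hne⟩
  have h2 := Finset.card_filter_add_card_filter_not (s := (Finset.univ : Finset (W n)))
    (fun w => w.1.perm⁻¹ i < w.1.perm⁻¹ j)
  rw [Finset.card_univ] at h2
  omega

theorem rootProd_dvd_det (N : Matrix (W n) (W n) (S n)) (hN : ∀ k, (fun w => N w k) ∈ H n) :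
    rootProd n ∣ N.det := by
  refine Finset.prod_dvd_of_isRelPrime ?_ ?_
  · rintro ⟨i, j, σ⟩ hp ⟨i', j', σ'⟩ hp' hne
    simp only [posRoots, Finset.coe_filter, Finset.mem_univ, true_and, Set.mem_ofPred_eq] at hp hp'
    exact (isRelPrime_root hp hp' hne).pow
  · rintro ⟨i, j, σ⟩ hp
    have hij : i < j := by simpa [posRoots] using hp
    simp only
    rw [← card_filter_not_lt i j hij.ne]
    refine pow_dvd_det N _ (fun w => refl i j hij.ne σ * w) _ ?_ ?_
    · intro w hw
      have hne : w.1.perm⁻¹ i ≠ w.1.perm⁻¹ j := fun h => hij.ne ((w.1.perm⁻¹).injective h)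
      simpa [refl] using lt_of_le_of_ne (not_lt.mp hw) hne.symm
    · intro w k
      exact root_dvd_of_mem_H (hN k) i j hij.ne σ w

theorem rootProd_ne_zero (n : ℕ) : rootProd n ≠ 0 := by
  refine Finset.prod_ne_zero_iff.mpr ?_
  rintro ⟨i, j, σ⟩ hp
  have hij : i < j := by simpa [posRoots] using hp
  exact pow_ne_zero _ (root_ne_zero hij.ne σ)

theorem totalDegree_rootProd (n : ℕ) :
    (rootProd n).totalDegree = (posRoots n).card * (Fintype.card (W n) / 2) := by
  have h : (rootProd n).IsHomogeneous (∑ p ∈ posRoots n, 1 * (Fintype.card (W n) / 2)) := by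
    refine IsHomogeneous.prod _ _ _ ?_
    rintro ⟨i, j, σ⟩ hp
    refine IsHomogeneous.pow ?_ _
    have hC : ((σ : ℤ) : S n) = C ((σ : ℤ) : ℝ) := by simp
    rw [root, hC]
    exact (isHomogeneous_X _ _).sub ((isHomogeneous_X _ _).C_mul _)
  rw [h.totalDegree (rootProd_ne_zero n)]
  simp

end Product

end TypeD
end
noncomputable section

namespace TypeD

open MvPolynomial

/-! ### Spanning over the invariants, and faithfulness of the action. -/

section Spanning

variable {n : ℕ}

theorem smul_C (w : W n) (r : ℝ) : w • (C r : S n) = C r := w.1.toAlgHom.commutes r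

theorem smul_X (w : W n) (k : Fin n) :
    w • (X k : S n) = ((w.1.sign k : ℤ) : S n) * X (w.1.perm k) :=
  SignedPerm.smul_X _ _

theorem mem_invariants {p : S n} : p ∈ invariants n ↔ ∀ w : W n, w • p = p := Iff.rfl

/-- Here the evenness of the sign changes enters. -/
theorem prod_X_mem_invariants : ∏ k, (X k : S n) ∈ invariants n := by
  intro w
  have h : w • ∏ k, (X k : S n) = ∏ k, w • (X k : S n) :=
    map_prod (MulSemiringAction.toRingHom (W n) (S n) w) _ _
  have h2 : ∏ k, ((w.1.sign k : ℤ) : S n) = 1 := by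
    have h3 := congrArg (fun u : ℤˣ => ((u : ℤ) : S n)) (mem_W.mp w.2)
    simpa using h3
  rw [h]
  simp only [smul_X, Finset.prod_mul_distrib]
  rw [h2, one_mul, Equiv.prod_comp w.1.perm fun k => (X k : S n)]

theorem coeff_prod_mem_invariants (d : ℕ) :
    (∏ k, (Polynomial.X - Polynomial.C ((X k : S n) ^ 2))).coeff d ∈ invariants n := by
  intro w
  set φ := MulSemiringAction.toRingHom (W n) (S n) w with hφ
  have h : ∀ k, φ (X k) ^ 2 = (X (w.1.perm k) : S n) ^ 2 := by
    intro k
    rw [hφ, MulSemiringAction.toRingHom_apply, smul_X]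
    rcases Int.units_eq_one_or (w.1.sign k) with h | h <;> simp [h]
  change φ _ = _
  rw [← Polynomial.coeff_map, Polynomial.map_prod]
  simp only [Polynomial.map_sub, Polynomial.map_X, Polynomial.map_C, RingHom.map_pow φ, h]
  rw [Equiv.prod_comp w.1.perm fun k => (Polynomial.X - Polynomial.C ((X k : S n) ^ 2))]

theorem mem_span_mono (s : S (n + 1)) :
    s ∈ Submodule.span (invariants (n + 1)) (mono '' (exps n : Set (Fin (n + 1) → ℕ))) := by
  refine mem_span_monomials n (invariants (n + 1)) X prod_X_mem_invariants
    coeff_prod_mem_invariants s ?_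
  induction s using MvPolynomial.induction_on with
  | C r => exact Subring.subset_closure (Or.inl fun w => smul_C w r)
  | add p q hp hq => exact add_mem hp hq
  | mul_X p k hp => exact mul_mem hp (Subring.subset_closure (Or.inr ⟨k, rfl⟩))

/-- Dedekind's theorem needs the characters to be distinct. -/
theorem smul_injective : Function.Injective fun w : W n =>
    (MulSemiringAction.toRingHom (W n) (S n) w : S n →* S n) := by
  intro w v h
  have hX : ∀ k, ((w.1.sign k : ℤ) : S n) * X (w.1.perm k) =
      ((v.1.sign k : ℤ) : S n) * X (v.1.perm k) := by
    intro k
    rw [← smul_X, ← smul_X]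
    exact DFunLike.congr_fun h (X k)
  have hcoeff : ∀ k, ((w.1.sign k : ℤ) : ℝ) =
      ((v.1.sign k : ℤ) : ℝ) * if v.1.perm k = w.1.perm k then 1 else 0 := by
    intro k
    have h1 := congrArg (coeff (Finsupp.single (w.1.perm k) 1)) (hX k)
    have hC : ∀ σ : ℤˣ, ((σ : ℤ) : S n) = C ((σ : ℤ) : ℝ) := by simp
    rw [hC, hC, coeff_C_mul, coeff_C_mul, coeff_X, coeff_X] at h1
    simpa [Finsupp.single_left_inj] using h1
  have hperm : ∀ k, v.1.perm k = w.1.perm k := by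
    intro k
    by_contra hne
    have h1 := hcoeff k
    rw [if_neg hne, mul_zero, Int.cast_eq_zero] at h1
    exact (w.1.sign k).ne_zero h1
  apply Subtype.ext
  ext k : 2
  · exact (hperm k).symm
  · have h1 := hcoeff k
    rw [if_pos (hperm k), mul_one, Int.cast_inj] at h1
    exact Units.ext h1

end Spanning

/-! ### The determinant of the classes and Cramer's rule. -/

section Matrix

variable {n : ℕ}

/-- A bijection between the Weyl group and the exponents of the monomial basis. -/
def equivExps (n : ℕ) : W (n + 1) ≃ exps n :=
  Fintype.equivOfCardEq (by rw [card_W, Fintype.card_coe, card_exps])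

/-- The square matrix with the classes `c_I` as columns. -/
def classMatrix (n : ℕ) : Matrix (W (n + 1)) (W (n + 1)) (S (n + 1)) :=
  Matrix.of fun w v => c (equivExps n v).1 w

theorem det_classMatrix_ne_zero (n : ℕ) : (classMatrix n).det ≠ 0 := by
  intro h
  obtain ⟨a, ha, ha0⟩ := Matrix.exists_vecMul_eq_zero_iff.mpr h
  have h1 : ∀ s : S (n + 1), ∑ w, a w * (w • s) = 0 := by
    intro s
    refine Submodule.span_induction (p := fun s _ => ∑ w, a w * (w • s) = 0) ?_ ?_ ?_ ?_
      (mem_span_mono s)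
    · rintro _ ⟨I, hI, rfl⟩
      have h2 := congrFun ha0 ((equivExps n).symm ⟨I, hI⟩)
      simpa [Matrix.vecMul, dotProduct, classMatrix, c, cT] using h2
    · simp
    · intro x y _ _ hx hy
      simp only [smul_add, mul_add, Finset.sum_add_distrib, hx, hy, add_zero]
    · intro r x _ hx
      have h2 : ∀ w : W (n + 1), a w * (w • (r • x)) = (r : S (n + 1)) * (a w * (w • x)) := by
        intro w
        rw [Subring.smul_def, smul_eq_mul, smul_mul', mem_invariants.mp r.2 w]
        ring
      simp only [h2, ← Finset.mul_sum, hx, mul_zero]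
  have h2 := (linearIndependent_monoidHom (S (n + 1)) (S (n + 1))).comp _ smul_injective
  rw [Fintype.linearIndependent_iff] at h2
  refine ha (funext (h2 a ?_))
  funext s
  simpa using h1 s

theorem totalDegree_c_le (I : Fin n → ℕ) (w : W n) : (c I w).totalDegree ≤ ∑ k, I k := by
  rw [c_apply]
  refine (totalDegree_finsetProd _ _).trans (Finset.sum_le_sum fun k _ => ?_)
  refine (totalDegree_pow _ _).trans ?_
  have h : (((w.1.sign k : ℤ) : S n) * X (w.1.perm k)).totalDegree ≤ 1 := by
    rcases Int.units_eq_one_or (w.1.sign k) with h | h <;> simp [h]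
  simpa using Nat.mul_le_mul_left (I k) h

theorem totalDegree_det_classMatrix_le (n : ℕ) :
    (classMatrix n).det.totalDegree ≤ ∑ I ∈ exps n, ∑ k, I k := by
  rw [Matrix.det_apply]
  refine totalDegree_finsetSum_le fun σ _ => ?_
  refine (totalDegree_smul_le _ _).trans ((totalDegree_finsetProd _ _).trans ?_)
  have h : ∑ I ∈ exps n, ∑ k, I k = ∑ v, ∑ k, (equivExps n v).1 k := by
    rw [← Finset.sum_coe_sort]
    exact (Equiv.sum_comp (equivExps n) fun I => ∑ k, I.1 k).symm
  rw [h]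
  exact Finset.sum_le_sum fun v _ => totalDegree_c_le _ _

theorem exists_det_classMatrix_eq (n : ℕ) :
    ∃ r : ℝ, r ≠ 0 ∧ (classMatrix n).det = rootProd (n + 1) * C r := by
  obtain ⟨q, hq⟩ := rootProd_dvd_det (classMatrix n) fun k => c_mem_H _
  have hne := det_classMatrix_ne_zero n
  have hq0 : q ≠ 0 := fun h => hne (by rw [hq, h, mul_zero])
  have hle := totalDegree_det_classMatrix_le n
  rw [hq, totalDegree_mul_of_isDomain (rootProd_ne_zero _) hq0, totalDegree_rootProd,
    card_posRoots, card_W] at hle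
  have hsum := two_mul_sum_exps n
  rw [card_exps] at hsum
  have hdeg : q.totalDegree = 0 := by
    -- In one variable `|W| = 1` and the halving truncates, but there are no roots and both degrees
    -- vanish; otherwise `|W|` is even.
    rcases n with _ | n
    · omega
    · have h2 : (n + 1 + 1).factorial * 2 ^ (n + 1) =
          2 * ((n + 1 + 1).factorial * 2 ^ (n + 1) / 2) := by
        rw [Nat.mul_div_cancel' (Dvd.dvd.mul_left (dvd_pow_self 2 n.succ_ne_zero) _)]
      rw [h2] at hsum
      generalize (n + 1 + 1).factorial * 2 ^ (n + 1) / 2 = t at *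
      nlinarith
  obtain ⟨r, hr⟩ : ∃ r, q = C r := ⟨_, totalDegree_eq_zero_iff_eq_C.mp hdeg⟩
  refine ⟨r, ?_, by rw [hq, hr]⟩
  rintro rfl
  exact hq0 (by rw [hr, map_zero])

/-- Replacing a column by `f` keeps all columns in `H`, so each Cramer numerator is divisible by
`rootProd`, which is the determinant up to a nonzero constant. -/
theorem exists_mulVec_eq {f : W (n + 1) → S (n + 1)} (hf : f ∈ H (n + 1)) :
    ∃ a, (classMatrix n).mulVec a = f := by
  obtain ⟨r, hr, hdet⟩ := exists_det_classMatrix_eq n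
  have h1 : ∀ k, rootProd (n + 1) ∣ (classMatrix n).cramer f k := by
    intro k
    rw [Matrix.cramer_apply]
    refine rootProd_dvd_det _ fun l => ?_
    by_cases h : l = k
    · subst h
      simpa using hf
    · simp only [Matrix.updateCol_apply, h, if_false]
      exact c_mem_H (equivExps n l).1
  choose q hq using h1
  refine ⟨fun k => C r⁻¹ * q k, ?_⟩
  have h2 : (classMatrix n).cramer f = (classMatrix n).det • fun k => C r⁻¹ * q k := by
    funext k
    have h3 : (C r : S (n + 1)) * C r⁻¹ = 1 := by rw [← C_mul, mul_inv_cancel₀ hr, C_1]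
    rw [hq, Pi.smul_apply, hdet, smul_eq_mul]
    linear_combination (-rootProd (n + 1) * q k) * h3
  have h4 := Matrix.mulVec_cramer (classMatrix n) f
  rw [h2, Matrix.mulVec_smul] at h4
  funext w
  exact mul_left_cancel₀ (det_classMatrix_ne_zero n) (congrFun h4 w)

theorem eq_zero_of_sum_smul_c (a : exps n → S (n + 1)) (h : ∀ w, ∑ I, a I * c I.1 w = 0) :
    a = 0 := by
  by_contra hne
  refine det_classMatrix_ne_zero n (Matrix.exists_mulVec_eq_zero_iff.mp
    ⟨fun v => a (equivExps n v), fun h0 => hne (funext fun I => ?_), funext fun w => ?_⟩)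
  · simpa using congrFun h0 ((equivExps n).symm I)
  · have h1 := h w
    rw [← Equiv.sum_comp (equivExps n)] at h1
    simpa [Matrix.mulVec, dotProduct, classMatrix, mul_comm] using h1

end Matrix

/-! ### The two bases. -/

section Bases

variable (n : ℕ)

theorem exists_basis_H : ∃ b : Module.Basis (exps n) (S (n + 1)) (H (n + 1)),
    ∀ I : exps n, (b I : W (n + 1) → S (n + 1)) = c I.1 := by
  let v : exps n → H (n + 1) := fun I => ⟨c I.1, c_mem_H I.1⟩
  have hcoe : ∀ (a : exps n → S (n + 1)) (w : W (n + 1)),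
      ((∑ I, a I • v I : H (n + 1)) : W (n + 1) → S (n + 1)) w = ∑ I, a I * c I.1 w := by
    intro a w
    simp [v]
  have hli : LinearIndependent (S (n + 1)) v := by
    rw [Fintype.linearIndependent_iff]
    intro a ha
    refine congrFun (eq_zero_of_sum_smul_c a fun w => ?_)
    rw [← hcoe, ha]
    rfl
  have hsp : ⊤ ≤ Submodule.span (S (n + 1)) (Set.range v) := by
    rintro ⟨f, hf⟩ _
    obtain ⟨a, ha⟩ := exists_mulVec_eq hf
    have h : (⟨f, hf⟩ : H (n + 1)) = ∑ I, a ((equivExps n).symm I) • v I := by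
      apply Subtype.ext
      funext w
      rw [hcoe, ← Equiv.sum_comp (equivExps n)]
      change f w = _
      rw [← ha]
      simp [Matrix.mulVec, dotProduct, classMatrix, mul_comm]
    rw [h]
    exact Submodule.sum_mem _ fun I _ => Submodule.smul_mem _ _ (Submodule.subset_span ⟨I, rfl⟩)
  exact ⟨Module.Basis.mk hli hsp, fun I => by rw [Module.Basis.mk_apply]⟩

theorem exists_basis_invariants : ∃ b : Module.Basis (exps n) (invariants (n + 1)) (S (n + 1)),
    ∀ I : exps n, b I = mono I.1 := by
  have hli : LinearIndependent (invariants (n + 1)) fun I : exps n => (mono I.1 : S (n + 1)) := by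
    rw [Fintype.linearIndependent_iff]
    intro a ha I
    refine Subtype.ext (congrFun (eq_zero_of_sum_smul_c (fun I => (a I : S (n + 1)))
      fun w => ?_) I)
    -- Applying `w` fixes the invariant coefficients and turns `x^I` into `c_I(w)`, giving a
    -- relation among the classes.
    have h := congrArg (w • ·) ha
    simp only [Finset.smul_sum, smul_zero] at h
    rw [← h]
    refine Finset.sum_congr rfl fun I _ => ?_
    rw [Subring.smul_def, smul_eq_mul, smul_mul', mem_invariants.mp (a I).2 w]
    rfl
  refine ⟨Module.Basis.mk hli fun s _ => ?_, fun I => by rw [Module.Basis.mk_apply]⟩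
  have h := mem_span_mono s
  rw [Set.image_eq_range] at h
  exact h

end Bases

end TypeD

end

theorem mainTheorem7 (n : ℕ) (hn : 2 ≤ n) :
    (∀ I ∈ TypeD.𝒟 n,
      TypeD.c I ∈ TypeD.H n ∧ ∀ w : TypeD.W n, TypeD.act w (TypeD.c I) = TypeD.c I) ∧
    (∃ b : Module.Basis (TypeD.𝒟 n) (TypeD.S n) (TypeD.H n),
      ∀ I : TypeD.𝒟 n, (b I : TypeD.W n → TypeD.S n) = TypeD.c I.1) ∧
    (∃ b : Module.Basis (TypeD.𝒟 n) (TypeD.invariants n) (TypeD.S n),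
      ∀ I : TypeD.𝒟 n, b I = TypeD.mono I.1) := by
  obtain ⟨m, rfl⟩ := Nat.exists_eq_add_of_le' hn
  refine ⟨fun I _ => ⟨TypeD.c_mem_H I, TypeD.act_c I⟩, ?_⟩
  rw [TypeD.𝒟_eq_exps]
  exact ⟨TypeD.exists_basis_H (m + 1), TypeD.exists_basis_invariants (m + 1)⟩
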